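/- Let $N,k\ge 1$ be integers and let $2^*=2N/(N-2)$ if $N\ge 3$, $2^*=\infty$ if $N\le 2$. Let $m_1,\dots,m_k>0$ and let $F\in C^1(\mathbb R^k,\mathbb R)$ be written as $$F(u)=\tfrac12\sum_{i=1}^k m_i^2|u_i|^2+R(u),\qquad R(0)=0 .$$ Assume that there are constants $c,c'\ge 0$ and exponents $2<p\le q<2^*$ such that $$|\nabla R(u)|\le c\,|u|^{p-1}+c'\,|u|^{q-1}\qquad\text{for all }u\in\mathbb R^k .$$ Let $H^1=H^1(\mathbb R^N,\mathbb R^k)$ be the space of functions $u=(u_1,\dots,u_k)$ all of whose components $u_i$ and weak partial derivatives $\partial_j u_i$ lie in $L^2(\mathbb R^N)$, with norm $\|u\|^2=\sum_i(\|u_i\|_{L^2}^2+\|\nabla u_i\|_{L^2}^2)$. Then $F\circ u\in L^1(\mathbb R^N)$ for every $u\in H^1$, and the Nemytski operator $T_F\colon H^1\to L^1(\mathbb R^N)$, $T_F(u)=F\circ u$, is continuous and is (Fréchet) differentiable at every point. Consequently the functional $$E(u,\omega)=\int_{\mathbb R^N}F(u)\,dx+\frac12\sum_{i=1}^k\|\nabla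 u_i\|_{L^2}^2+\frac12\sum_{i=1}^k\omega_i^2\|u_i\|_{L^2}^2$$ is (Fréchet) differentiable at every point of $H^1\times\mathbb R^k$. -/

import Mathlib

open MeasureTheory
open scoped ContDiff

noncomputable section

namespace EllipticSystem

/-- `ℝ^N` with its Euclidean norm and Lebesgue measure `volume`. -/
abbrev Eucl (N : ℕ) : Type := EuclideanSpace ℝ (Fin N)

/-- The real space `L²(ℝ^N)`. -/
abbrev L2 (N : ℕ) : Type := Lp ℝ 2 (volume : Measure (Eucl N))

/-- `g` is the weak partial derivative `∂_j u` of `u` on `ℝ^N`, tested against `C_c^∞`. -/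
def IsWeakPartialDeriv {N : ℕ} (j : Fin N) (u g : L2 N) : Prop :=
  ∀ φ : Eucl N → ℝ, ContDiff ℝ ∞ φ → HasCompactSupport φ →
    ∫ x, u x * fderiv ℝ φ x (EuclideanSpace.single j 1) = - ∫ x, g x * φ x

lemma integrable_mul_of_hasCompactSupport {N : ℕ} (u : L2 N) {ψ : Eucl N → ℝ}
    (hψ : Continuous ψ) (hc : HasCompactSupport ψ) : Integrable (fun x => u x * ψ x) :=
  (Lp.memLp u).integrable_mul (q := 2) (hψ.memLp_of_hasCompactSupport hc)

lemma integrable_mul_fderiv {N : ℕ} (j : Fin N) (u : L2 N) {φ : Eucl N → ℝ}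
    (hφ : ContDiff ℝ ∞ φ) (hc : HasCompactSupport φ) :
    Integrable (fun x => u x * fderiv ℝ φ x (EuclideanSpace.single j 1)) :=
  integrable_mul_of_hasCompactSupport u
    ((hφ.continuous_fderiv (by simp)).clm_apply continuous_const)
    (hc.fderiv_apply (𝕜 := ℝ) _)

lemma IsWeakPartialDeriv.zero {N : ℕ} (j : Fin N) : IsWeakPartialDeriv j (0 : L2 N) 0 := by
  intro φ _ _
  have h : ∀ ψ : Eucl N → ℝ, ∫ x, (0 : L2 N) x * ψ x = 0 := by
    intro ψ
    rw [integral_eq_zero_of_ae]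
    filter_upwards [Lp.coeFn_zero ℝ 2 (volume : Measure (Eucl N))] with x hx
    simp only [hx, Pi.zero_apply, zero_mul]
  rw [h, h, neg_zero]

lemma IsWeakPartialDeriv.add {N : ℕ} {j : Fin N} {u v g h : L2 N}
    (hu : IsWeakPartialDeriv j u g) (hv : IsWeakPartialDeriv j v h) :
    IsWeakPartialDeriv j (u + v) (g + h) := by
  intro φ hφ hc
  have key : ∀ (a b : L2 N) (ψ : Eucl N → ℝ), Integrable (fun x => a x * ψ x) →
      Integrable (fun x => b x * ψ x) →
      ∫ x, (a + b : L2 N) x * ψ x = (∫ x, a x * ψ x) + ∫ x, b x * ψ x := by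
    intro a b ψ ha hb
    rw [← integral_add ha hb]
    refine integral_congr_ae ?_
    filter_upwards [Lp.coeFn_add a b] with x hx
    rw [hx, Pi.add_apply, add_mul]
  rw [key u v _ (integrable_mul_fderiv j u hφ hc) (integrable_mul_fderiv j v hφ hc),
    key g h _ (integrable_mul_of_hasCompactSupport g hφ.continuous hc)
      (integrable_mul_of_hasCompactSupport h hφ.continuous hc), hu φ hφ hc, hv φ hφ hc]
  ring

lemma IsWeakPartialDeriv.smul {N : ℕ} {j : Fin N} {u g : L2 N} (c : ℝ)
    (hu : IsWeakPartialDeriv j u g) : IsWeakPartialDeriv j (c • u) (c • g) := by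
  intro φ hφ hc
  have key : ∀ (a : L2 N) (ψ : Eucl N → ℝ),
      ∫ x, (c • a : L2 N) x * ψ x = c * ∫ x, a x * ψ x := by
    intro a ψ
    rw [← integral_const_mul]
    refine integral_congr_ae ?_
    filter_upwards [Lp.coeFn_smul c a] with x hx
    rw [hx, Pi.smul_apply, smul_eq_mul, mul_assoc]
  rw [key, key, hu φ hφ hc]
  ring

/-- The scalar Sobolev space `H¹(ℝ^N)`, realised as the space of pairs `(u, ∇u)` where `u ∈ L²`
has weak gradient `∇u = (∂₁u, …, ∂_N u) ∈ (L²)^N`; the inherited norm is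
`‖u‖² = ‖u‖²_{L²} + ∑_j ‖∂_j u‖²_{L²}`. -/
def sobolevH1 (N : ℕ) : Submodule ℝ (WithLp 2 (L2 N × PiLp 2 (fun _ : Fin N => L2 N))) where
  carrier := {w | ∀ j, IsWeakPartialDeriv j w.fst (w.snd j)}
  zero_mem' := fun j => IsWeakPartialDeriv.zero j
  add_mem' := fun ha hb j => (ha j).add (hb j)
  smul_mem' := fun c _ ha j => (ha j).smul c

/-- `H¹(ℝ^N, ℝ^k)`: the `k`-tuples of elements of `H¹(ℝ^N)`, with
`‖u‖² = ∑_i (‖u_i‖²_{L²} + ‖∇u_i‖²_{L²})`. -/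
abbrev H1 (N k : ℕ) : Type := PiLp 2 (fun _ : Fin k => sobolevH1 N)

/-- The `i`-th component `u_i ∈ L²(ℝ^N)` of `u`. -/
def H1.comp {N k : ℕ} (u : H1 N k) (i : Fin k) : L2 N := (u i).val.fst

/-- The weak gradient `∇u_i ∈ L²(ℝ^N)^N` of the `i`-th component of `u`. -/
def H1.grad {N k : ℕ} (u : H1 N k) (i : Fin k) : PiLp 2 (fun _ : Fin N => L2 N) :=
  (u i).val.snd

/-- The function `x ↦ u(x) = (u_1(x), …, u_k(x))` from `ℝ^N` to `ℝ^k`. -/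
def H1.toFun {N k : ℕ} (u : H1 N k) (x : Eucl N) : Eucl k :=
  WithLp.toLp 2 (fun i => u.comp i x)

/-- The critical Sobolev exponent: `2* = 2N/(N-2)` for `N ≥ 3`, and `2* = ∞` for `N ≤ 2`. -/
def criticalExponent (N : ℕ) : EReal :=
  if N ≤ 2 then ⊤ else ((2 * (N : ℝ) / ((N : ℝ) - 2) : ℝ) : EReal)

/-- The Nemytski operator `T_F : H¹ → L¹`, `u ↦ F ∘ u`, given that `F ∘ u` is always integrable. -/
def nemytski {N k : ℕ} (F : Eucl k → ℝ)
    (hF : ∀ u : H1 N k, Integrable (fun x => F (u.toFun x)) volume) (u : H1 N k) :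
    Lp ℝ 1 (volume : Measure (Eucl N)) :=
  (hF u).toL1 (fun x => F (u.toFun x))

/-- The energy `E(u, ω) = ∫ F(u) + ½ ∑_i ‖∇u_i‖²_{L²} + ½ ∑_i ω_i² ‖u_i‖²_{L²}`. -/
def energy {N k : ℕ} (F : Eucl k → ℝ) (z : H1 N k × Eucl k) : ℝ :=
  (∫ x, F (z.1.toFun x)) + 1 / 2 * ∑ i, ‖z.1.grad i‖ ^ 2
    + 1 / 2 * ∑ i, z.2 i ^ 2 * ‖z.1.comp i‖ ^ 2

end EllipticSystem

end

/-!
A `C¹` map whose derivative has the growth `|v| ^ (s - 1)`, `1 < s < ∞`, induces a differentiable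
Nemytski operator `L^s → L¹`: by Hölder's inequality with conjugate exponent `t`, the remainder at
`u` is at most `‖τ(u, h)‖_{L^t} ‖h‖_{L^s}`, where `τ` is the Taylor quotient of the map; `τ` is
dominated by `|u| ^ (s - 1) + |h| ^ (s - 1)` and tends to `0` almost everywhere along subsequences
of `h → 0`, so its norm tends to `0`. A cutoff near the origin writes `F = F₁ + F₂` with `F₁'` of
linear growth and `F₂'` of growth `|v| ^ (r - 1)`, `q ≤ r`, and `T_F` is the sum of the operators
of `F₁` on `L²` and of `F₂` on `L^r`, both precomposed with a Sobolev embedding. The embedding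
passes from test functions `f` to `H¹` by mollification and Fatou's lemma. For `N ≤ 2`, arbitrarily
large exponents `r` come from induction on powers: `‖f ^ (n + 2)‖_{L²}` is controlled by
`‖f ^ (n + 1)‖_{L²}`, by the Gagliardo-Nirenberg inequality for `N = 2` and by a bound on `sup |f|`
for `N = 1`.
-/

noncomputable section

namespace EllipticSystem

open Filter
open scoped ENNReal NNReal Topology

section TaylorQuotient

variable {V W : Type*} [NormedAddCommGroup V] [NormedSpace ℝ V]
  [NormedAddCommGroup W] [NormedSpace ℝ W] {G : V → W} {s : ℝ} {K : ℝ≥0}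

/-- The relative error `‖G(v + w) - G(v) - G'(v)w‖ / ‖w‖` of the first-order Taylor expansion of `G`
at `v`. It is `0` at `w = 0` because `x / 0 = 0`. -/
def taylorQuotient (G : V → W) (v w : V) : ℝ := ‖G (v + w) - G v - fderiv ℝ G v w‖ / ‖w‖

lemma taylorQuotient_nonneg (G : V → W) (v w : V) : 0 ≤ taylorQuotient G v w := by
  unfold taylorQuotient; positivity

lemma taylorQuotient_mul_norm (G : V → W) (v w : V) :
    taylorQuotient G v w * ‖w‖ = ‖G (v + w) - G v - fderiv ℝ G v w‖ := by
  rcases eq_or_ne w 0 with rfl | hw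
  · simp
  · exact div_mul_cancel₀ _ (norm_ne_zero_iff.2 hw)

lemma tendsto_taylorQuotient {v : V} (hG : DifferentiableAt ℝ G v) :
    Tendsto (taylorQuotient G v) (𝓝 0) (𝓝 0) :=
  (hasFDerivAt_iff_isLittleO_nhds_zero.1 hG.hasFDerivAt).norm_norm.tendsto_div_nhds_zero

lemma add_rpow_le_two_rpow_mul {a b : ℝ} (ha : 0 ≤ a) (hb : 0 ≤ b) (hs : 0 ≤ s) :
    (a + b) ^ s ≤ 2 ^ s * (a ^ s + b ^ s) := by
  wlog hab : a ≤ b generalizing a b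
  · simpa only [add_comm] using this hb ha (le_of_not_ge hab)
  calc (a + b) ^ s ≤ (2 * b) ^ s := by gcongr; linarith
    _ = 2 ^ s * b ^ s := Real.mul_rpow zero_le_two hb
    _ ≤ 2 ^ s * (a ^ s + b ^ s) := by gcongr; exact le_add_of_nonneg_left (by positivity)

lemma taylorQuotient_le (hG : Differentiable ℝ G) (hs : 0 ≤ s)
    (hK : ∀ v, ‖fderiv ℝ G v‖ ≤ K * ‖v‖ ^ s) (v w : V) :
    taylorQuotient G v w ≤ 2 * K * 2 ^ s * (‖v‖ ^ s + ‖w‖ ^ s) := by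
  have hball : ∀ x ∈ Metric.closedBall (0 : V) (‖v‖ + ‖w‖),
      ‖fderiv ℝ G x - fderiv ℝ G v‖ ≤ 2 * K * (‖v‖ + ‖w‖) ^ s := fun x hx => by
    calc ‖fderiv ℝ G x - fderiv ℝ G v‖ ≤ K * ‖x‖ ^ s + K * ‖v‖ ^ s :=
          (norm_sub_le _ _).trans (add_le_add (hK x) (hK v))
      _ ≤ K * (‖v‖ + ‖w‖) ^ s + K * (‖v‖ + ‖w‖) ^ s := by
          gcongr
          · exact mem_closedBall_zero_iff.1 hx
          · exact le_add_of_nonneg_right (norm_nonneg w)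
      _ = 2 * K * (‖v‖ + ‖w‖) ^ s := by ring
  have hmv := (convex_closedBall (0 : V) (‖v‖ + ‖w‖)).norm_image_sub_le_of_norm_fderiv_le'
    (fun x _ => hG x) hball (mem_closedBall_zero_iff.2 (le_add_of_nonneg_right (norm_nonneg w)))
    (mem_closedBall_zero_iff.2 (norm_add_le v w))
  rw [add_sub_cancel_left] at hmv
  calc taylorQuotient G v w ≤ 2 * K * (‖v‖ + ‖w‖) ^ s :=
        div_le_of_le_mul₀ (norm_nonneg w) (by positivity) hmv
    _ ≤ 2 * K * (2 ^ s * (‖v‖ ^ s + ‖w‖ ^ s)) := by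
        gcongr; exact add_rpow_le_two_rpow_mul (norm_nonneg v) (norm_nonneg w) hs
    _ = 2 * K * 2 ^ s * (‖v‖ ^ s + ‖w‖ ^ s) := by ring

lemma norm_le_mul_norm_of_norm_fderiv_le {g : ℝ → ℝ} (hg : MonotoneOn g (Set.Ici 0))
    (hG : Differentiable ℝ G) (hG0 : G 0 = 0) (hle : ∀ v, ‖fderiv ℝ G v‖ ≤ g ‖v‖) (v : V) :
    ‖G v‖ ≤ g ‖v‖ * ‖v‖ := by
  have hball : ∀ x ∈ Metric.closedBall (0 : V) ‖v‖, ‖fderiv ℝ G x‖ ≤ g ‖v‖ := fun x hx =>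
    (hle x).trans (hg (norm_nonneg x) (norm_nonneg v) (mem_closedBall_zero_iff.1 hx))
  simpa [hG0] using (convex_closedBall (0 : V) ‖v‖).norm_image_sub_le_of_norm_fderiv_le
    (fun x _ => hG x) hball (x := 0) (y := v) (by simp) (by simp)

end TaylorQuotient

section LpNemytski

variable {α : Type*} {mα : MeasurableSpace α} {μ : Measure α} {p q : ℝ≥0∞}

lemma tendsto_eLpNorm_of_dominated {ρ : ℕ → α → ℝ} {a : α → ℝ} (hq0 : q ≠ 0) (hq : q ≠ ⊤)
    (hρ : ∀ n, AEStronglyMeasurable (ρ n) μ) (ha : MemLp a q μ)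
    (hle : ∀ n, ∀ᵐ x ∂μ, ‖ρ n x‖ ≤ ‖a x‖)
    (hlim : ∀ᵐ x ∂μ, Tendsto (fun n => ρ n x) atTop (𝓝 0)) :
    Tendsto (fun n => eLpNorm (ρ n) q μ) atTop (𝓝 0) := by
  have hq' : 0 < q.toReal := ENNReal.toReal_pos hq0 hq
  have hint : Tendsto (fun n => ∫⁻ x, ‖ρ n x‖ₑ ^ q.toReal ∂μ) atTop (𝓝 (∫⁻ _, 0 ∂μ)) := by
    refine tendsto_lintegral_of_dominated_convergence' (fun x => ‖a x‖ₑ ^ q.toReal)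
      (fun n => (hρ n).enorm.pow_const _) (fun n => ?_)
      (lintegral_rpow_enorm_lt_top_of_eLpNorm_lt_top hq0 hq ha.2).ne ?_
    · filter_upwards [hle n] with x hx
      gcongr
      exact enorm_le_iff_norm_le.2 hx
    · filter_upwards [hlim] with x hx
      simpa [hq'] using hx.enorm.ennrpow_const q.toReal
  simp_rw [eLpNorm_eq_lintegral_rpow_enorm_toReal hq0 hq]
  simpa [hq'] using hint.ennrpow_const (1 / q.toReal)

lemma tendsto_eLpNorm_of_dominated_add [Fact (1 ≤ q)] {ρ b : ℕ → α → ℝ} {a : α → ℝ} (hq : q ≠ ⊤)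
    (hρ : ∀ n, AEStronglyMeasurable (ρ n) μ) (hρ0 : ∀ n x, 0 ≤ ρ n x) (ha0 : ∀ x, 0 ≤ a x)
    (ha : MemLp a q μ) (hb : ∀ n, AEStronglyMeasurable (b n) μ)
    (hb0 : ∀ n x, 0 ≤ b n x) (hle : ∀ n x, ρ n x ≤ a x + b n x)
    (hlim : ∀ᵐ x ∂μ, Tendsto (fun n => ρ n x) atTop (𝓝 0))
    (hblim : Tendsto (fun n => eLpNorm (b n) q μ) atTop (𝓝 0)) :
    Tendsto (fun n => eLpNorm (ρ n) q μ) atTop (𝓝 0) := by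
  have hq1 : 1 ≤ q := Fact.out
  have hmin : Tendsto (fun n => eLpNorm (fun x => min (ρ n x) (a x)) q μ) atTop (𝓝 0) := by
    refine tendsto_eLpNorm_of_dominated (zero_lt_one.trans_le hq1).ne' hq
      (fun n => (hρ n).inf ha.1) ha (fun n => .of_forall fun x => ?_) ?_
    · rw [Real.norm_of_nonneg (le_min (hρ0 n x) (ha0 x)), Real.norm_of_nonneg (ha0 x)]
      exact min_le_right _ _
    · filter_upwards [hlim] with x hx
      simpa [ha0 x] using hx.min (tendsto_const_nhds (x := a x))
  refine tendsto_of_tendsto_of_tendsto_of_le_of_le tendsto_const_nhds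
    (by simpa using hmin.add hblim) (fun n => zero_le) fun n => ?_
  refine le_trans (eLpNorm_mono_real fun x => ?_) (eLpNorm_add_le ((hρ n).inf ha.1) (hb n) hq1)
  rw [Real.norm_of_nonneg (hρ0 n x)]
  rcases le_total (ρ n x) (a x) with h | h
  · simpa [h] using hb0 n x
  · simpa [h] using hle n x

lemma toReal_sub_one_pos [q.HolderConjugate p] (hp : p ≠ ⊤) (hq : q ≠ ⊤) : 0 < p.toReal - 1 :=
  (inferInstance : q.HolderConjugate p).symm.toReal_of_ne_top hp hq |>.sub_one_pos

lemma mul_ofReal_toReal_sub_one [q.HolderConjugate p] (hp : p ≠ ⊤) (hq : q ≠ ⊤) :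
    q * ENNReal.ofReal (p.toReal - 1) = p := by
  have hconj : p.toReal.HolderConjugate q.toReal :=
    (inferInstance : q.HolderConjugate p).symm.toReal_of_ne_top hp hq
  rw [← ENNReal.ofReal_toReal hq, ← ENNReal.ofReal_mul ENNReal.toReal_nonneg,
    ← ENNReal.ofReal_toReal hp, ENNReal.toReal_ofReal ENNReal.toReal_nonneg, mul_sub_one,
    mul_comm, hconj.mul_eq_add, add_sub_cancel_right]

variable {V W : Type*} [NormedAddCommGroup V] [NormedAddCommGroup W]

lemma eLpNorm_norm_rpow_sub_one [q.HolderConjugate p] (hp : p ≠ ⊤) (hq : q ≠ ⊤) (f : α → V) :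
    eLpNorm (fun x => ‖f x‖ ^ (p.toReal - 1)) q μ = eLpNorm f p μ ^ (p.toReal - 1) := by
  rw [eLpNorm_norm_rpow f (toReal_sub_one_pos (q := q) hp hq),
    mul_ofReal_toReal_sub_one hp hq]

lemma memLp_norm_rpow_sub_one [q.HolderConjugate p] (hp : p ≠ ⊤) (hq : q ≠ ⊤) {f : α → V}
    (hf : MemLp f p μ) : MemLp (fun x => ‖f x‖ ^ (p.toReal - 1)) q μ := by
  refine ⟨(hf.1.norm.aemeasurable.pow_const _).aestronglyMeasurable, ?_⟩
  rw [eLpNorm_norm_rpow_sub_one hp hq]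
  exact ENNReal.rpow_lt_top_of_nonneg (toReal_sub_one_pos (q := q) hp hq).le hf.2.ne

/-- The Nemytski operator `u ↦ G ∘ u` from `L^p` to `L¹`, given that `G ∘ u` is always
integrable. -/
def lpNemytski (G : V → W) (hint : ∀ u : Lp V p μ, Integrable (fun x => G (u x)) μ)
    (u : Lp V p μ) : Lp W 1 μ :=
  (hint u).toL1 (fun x => G (u x))

lemma coeFn_lpNemytski {G : V → W} (hint : ∀ u : Lp V p μ, Integrable (fun x => G (u x)) μ)
    (u : Lp V p μ) : lpNemytski G hint u =ᵐ[μ] fun x => G (u x) :=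
  (hint u).coeFn_toL1

variable [NormedSpace ℝ V] [NormedSpace ℝ W]
  {G : V → W} {K : ℝ≥0}

lemma integrable_comp (hp1 : 1 < p) (hp : p ≠ ⊤) (hG : ContDiff ℝ 1 G) (hG0 : G 0 = 0)
    (hK : ∀ v, ‖fderiv ℝ G v‖ ≤ K * ‖v‖ ^ (p.toReal - 1)) {f : α → V} (hf : MemLp f p μ) :
    Integrable (fun x => G (f x)) μ := by
  have : Fact (1 ≤ p) := ⟨hp1.le⟩
  let q := p.conjExponent
  have hq : q ≠ ⊤ := ((ENNReal.HolderConjugate.lt_top_iff_one_lt q p).2 hp1).ne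
  have hprod : Integrable (fun x => K * ‖f x‖ ^ (p.toReal - 1) * ‖f x‖) μ :=
    ((memLp_norm_rpow_sub_one (q := q) hp hq hf).const_mul (K : ℝ)).integrable_mul (q := p)
      hf.norm
  refine hprod.mono (hG.continuous.comp_aestronglyMeasurable hf.1) (.of_forall fun x => ?_)
  have hmono : MonotoneOn (fun t : ℝ => K * t ^ (p.toReal - 1)) (Set.Ici 0) := by
    intro a ha b _ hab
    have ha' : 0 ≤ a := ha
    have hs := (toReal_sub_one_pos (q := q) hp hq).le
    dsimp only
    gcongr
  exact (norm_le_mul_norm_of_norm_fderiv_le hmono (hG.differentiable one_ne_zero) hG0 hK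
    (f x)).trans (le_abs_self _)

variable [q.HolderConjugate p]

lemma memLp_fderiv_comp (hp : p ≠ ⊤) (hq : q ≠ ⊤) (hG : ContDiff ℝ 1 G)
    (hK : ∀ v, ‖fderiv ℝ G v‖ ≤ K * ‖v‖ ^ (p.toReal - 1)) {f : α → V} (hf : MemLp f p μ) :
    MemLp (fun x => fderiv ℝ G (f x)) q μ := by
  refine ((memLp_norm_rpow_sub_one hp hq hf).const_mul (K : ℝ)).mono
    ((hG.continuous_fderiv one_ne_zero).comp_aestronglyMeasurable hf.1) (.of_forall fun x => ?_)
  exact (hK (f x)).trans (le_abs_self _)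

lemma aestronglyMeasurable_taylorQuotient (hG : ContDiff ℝ 1 G) {f h : α → V}
    (hf : AEStronglyMeasurable f μ) (hh : AEStronglyMeasurable h μ) :
    AEStronglyMeasurable (fun x => taylorQuotient G (f x) (h x)) μ := by
  have hfderiv := (hG.continuous_fderiv one_ne_zero).comp_aestronglyMeasurable hf
  have hnum : AEStronglyMeasurable
      (fun x => G (f x + h x) - G (f x) - fderiv ℝ G (f x) (h x)) μ :=
    ((hG.continuous.comp_aestronglyMeasurable (hf.add hh)).sub
      (hG.continuous.comp_aestronglyMeasurable hf)).sub
      (isBoundedBilinearMap_apply.continuous.comp_aestronglyMeasurable (hfderiv.prodMk hh))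
  exact (hnum.norm.aemeasurable.div hh.norm.aemeasurable).aestronglyMeasurable

lemma tendsto_eLpNorm_taylorQuotient [Fact (1 ≤ p)] (hp : p ≠ ⊤) (hq : q ≠ ⊤)
    (hG : ContDiff ℝ 1 G) (hK : ∀ v, ‖fderiv ℝ G v‖ ≤ K * ‖v‖ ^ (p.toReal - 1))
    (u : Lp V p μ) :
    Tendsto (fun h : Lp V p μ => eLpNorm (fun x => taylorQuotient G (u x) (h x)) q μ)
      (𝓝 0) (𝓝 0) := by
  have hs : 0 < p.toReal - 1 := toReal_sub_one_pos (q := q) hp hq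
  have : Fact (1 ≤ q) := ⟨ENNReal.HolderConjugate.one_le q p⟩
  refine tendsto_of_subseq_tendsto fun h hh => ?_
  obtain ⟨n, hn, hae⟩ := (tendstoInMeasure_of_tendsto_Lp hh).exists_seq_tendsto_ae
  refine ⟨n, ?_⟩
  set C : ℝ := 2 * K * 2 ^ (p.toReal - 1)
  have : 0 ≤ C := by positivity
  refine tendsto_eLpNorm_of_dominated_add hq
    (a := fun x => C * ‖u x‖ ^ (p.toReal - 1))
    (b := fun i x => C * ‖h (n i) x‖ ^ (p.toReal - 1))
    (fun i => aestronglyMeasurable_taylorQuotient hG (Lp.aestronglyMeasurable u)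
      (Lp.aestronglyMeasurable _))
    (fun i x => taylorQuotient_nonneg G _ _) (fun x => by positivity)
    ((memLp_norm_rpow_sub_one hp hq (Lp.memLp u)).const_mul C)
    (fun i => ((memLp_norm_rpow_sub_one hp hq (Lp.memLp _)).const_mul C).1)
    (fun i x => by positivity) (fun i x => ?_) ?_ ?_
  · rw [← mul_add]
    exact taylorQuotient_le (hG.differentiable one_ne_zero) hs.le hK _ _
  · filter_upwards [hae, Lp.coeFn_zero V p μ] with x hx h0
    rw [h0] at hx
    exact (tendsto_taylorQuotient (hG.differentiable one_ne_zero (u x))).comp hx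
  · have hnorm : Tendsto (fun i => eLpNorm (h (n i)) p μ) atTop (𝓝 0) := by
      simpa [Function.comp_def, Lp.enorm_def] using (hh.comp hn.tendsto_atTop).enorm
    simp_rw [← smul_eq_mul, ← Pi.smul_def, eLpNorm_const_smul,
      eLpNorm_norm_rpow_sub_one (q := q) hp hq]
    simpa [hs] using ENNReal.Tendsto.const_mul (hnorm.ennrpow_const (p.toReal - 1))
      (.inr (enorm_ne_top (x := C)))

/-- The derivative of `lpNemytski G` at `u`: multiplication by `G' ∘ u ∈ L^q`, which maps `L^p` to
`L¹` by Hölder's inequality. -/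
def lpNemytskiFDeriv [Fact (1 ≤ p)] [Fact (1 ≤ q)] {u : Lp V p μ}
    (hu : MemLp (fun x => fderiv ℝ G (u x)) q μ) : Lp V p μ →L[ℝ] Lp W 1 μ :=
  (ContinuousLinearMap.id ℝ (V →L[ℝ] W)).holderL μ q p 1 hu.toLp

lemma coeFn_lpNemytskiFDeriv [Fact (1 ≤ p)] [Fact (1 ≤ q)] {u : Lp V p μ}
    (hu : MemLp (fun x => fderiv ℝ G (u x)) q μ) (h : Lp V p μ) :
    lpNemytskiFDeriv hu h =ᵐ[μ] fun x => fderiv ℝ G (u x) (h x) := by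
  filter_upwards [(ContinuousLinearMap.id ℝ (V →L[ℝ] W)).coeFn_holder (r := 1) hu.toLp h,
    hu.coeFn_toLp] with x hx hux
  rw [hux] at hx
  exact hx

lemma coeFn_lpNemytski_add_sub_sub [Fact (1 ≤ p)] [Fact (1 ≤ q)]
    (hint : ∀ u : Lp V p μ, Integrable (fun x => G (u x)) μ) {u : Lp V p μ}
    (hu : MemLp (fun x => fderiv ℝ G (u x)) q μ) (h : Lp V p μ) :
    lpNemytski G hint (u + h) - lpNemytski G hint u - lpNemytskiFDeriv hu h
      =ᵐ[μ] fun x => G (u x + h x) - G (u x) - fderiv ℝ G (u x) (h x) := by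
  filter_upwards [Lp.coeFn_sub (lpNemytski G hint (u + h) - lpNemytski G hint u)
      (lpNemytskiFDeriv hu h), Lp.coeFn_sub (lpNemytski G hint (u + h)) (lpNemytski G hint u),
    coeFn_lpNemytski hint (u + h), coeFn_lpNemytski hint u, coeFn_lpNemytskiFDeriv hu h,
    Lp.coeFn_add u h] with x hsub₂ hsub₁ huh hux hh hadd
  rw [hsub₂, Pi.sub_apply, hsub₁, Pi.sub_apply, huh, hux, hh, hadd, Pi.add_apply]

lemma enorm_lpNemytski_add_sub_sub_le [Fact (1 ≤ p)] [Fact (1 ≤ q)] (hG : ContDiff ℝ 1 G)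
    (hint : ∀ u : Lp V p μ, Integrable (fun x => G (u x)) μ) {u : Lp V p μ}
    (hu : MemLp (fun x => fderiv ℝ G (u x)) q μ) (h : Lp V p μ) :
    ‖lpNemytski G hint (u + h) - lpNemytski G hint u - lpNemytskiFDeriv hu h‖ₑ
      ≤ eLpNorm (fun x => taylorQuotient G (u x) (h x)) q μ * ‖h‖ₑ := by
  have hτ := aestronglyMeasurable_taylorQuotient hG (Lp.aestronglyMeasurable u)
    (Lp.aestronglyMeasurable h)
  rw [Lp.enorm_def, eLpNorm_congr_ae (coeFn_lpNemytski_add_sub_sub hint hu h), Lp.enorm_def]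
  calc eLpNorm (fun x => G (u x + h x) - G (u x) - fderiv ℝ G (u x) (h x)) 1 μ
      = eLpNorm (fun x => taylorQuotient G (u x) (h x) * ‖h x‖) 1 μ := by
        simp_rw [taylorQuotient_mul_norm]
        exact (eLpNorm_norm _).symm
    _ ≤ eLpNorm (fun x => taylorQuotient G (u x) (h x)) q μ * eLpNorm (fun x => ‖h x‖) p μ :=
        eLpNorm_smul_le_mul_eLpNorm (φ := fun x => taylorQuotient G (u x) (h x))
          (Lp.aestronglyMeasurable h).norm hτ
    _ = _ := by rw [eLpNorm_norm]

lemma hasFDerivAt_of_enorm_sub_le {E F : Type*} [NormedAddCommGroup E] [NormedSpace ℝ E]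
    [NormedAddCommGroup F] [NormedSpace ℝ F] {T : E → F} {T' : E →L[ℝ] F} {u : E} {c : E → ℝ≥0∞}
    (hc : Tendsto c (𝓝 0) (𝓝 0)) (hle : ∀ h, ‖T (u + h) - T u - T' h‖ₑ ≤ c h * ‖h‖ₑ) :
    HasFDerivAt T T' u := by
  rw [hasFDerivAt_iff_isLittleO_nhds_zero, Asymptotics.isLittleO_iff]
  intro ε hε
  filter_upwards [hc.eventually_le_const (ENNReal.ofReal_pos.2 hε)] with h hh
  rw [← ENNReal.ofReal_le_ofReal_iff (by positivity), ENNReal.ofReal_mul hε.le, ofReal_norm,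
    ofReal_norm]
  exact (hle h).trans (by gcongr)

theorem differentiable_lpNemytski [Fact (1 ≤ p)] (hp1 : 1 < p) (hp : p ≠ ⊤)
    (hG : ContDiff ℝ 1 G) (hK : ∀ v, ‖fderiv ℝ G v‖ ≤ K * ‖v‖ ^ (p.toReal - 1))
    (hint : ∀ u : Lp V p μ, Integrable (fun x => G (u x)) μ) :
    Differentiable ℝ (lpNemytski G hint) := by
  intro u
  let q := p.conjExponent
  have hq : q ≠ ⊤ := ((ENNReal.HolderConjugate.lt_top_iff_one_lt q p).2 hp1).ne
  have : Fact (1 ≤ q) := ⟨ENNReal.HolderConjugate.one_le q p⟩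
  have hu : MemLp (fun x => fderiv ℝ G (u x)) q μ := memLp_fderiv_comp hp hq hG hK (Lp.memLp u)
  exact (hasFDerivAt_of_enorm_sub_le (tendsto_eLpNorm_taylorQuotient (q := q) hp hq hG hK u)
    (enorm_lpNemytski_add_sub_sub_le hG hint hu)).differentiableAt

end LpNemytski

section GrowthSplitting

variable {V W : Type*} [NormedAddCommGroup V] [NormedSpace ℝ V]
  [NormedAddCommGroup W] [NormedSpace ℝ W]

lemma norm_fderiv_smul_le {χ : V → ℝ} {F : V → W} {v : V} {A D : ℝ} (hχ : DifferentiableAt ℝ χ v)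
    (hF : DifferentiableAt ℝ F v) (hχ1 : |χ v| ≤ 1) (hD : ‖v‖ * ‖fderiv ℝ χ v‖ ≤ D)
    (hFv : ‖F v‖ ≤ A * ‖v‖) (hF' : ‖fderiv ℝ F v‖ ≤ A) :
    ‖fderiv ℝ (fun x => χ x • F x) v‖ ≤ (1 + D) * A := by
  have hA : 0 ≤ A := (norm_nonneg _).trans hF'
  rw [fderiv_fun_smul hχ hF]
  calc ‖χ v • fderiv ℝ F v + (fderiv ℝ χ v).smulRight (F v)‖
      ≤ |χ v| * ‖fderiv ℝ F v‖ + ‖fderiv ℝ χ v‖ * ‖F v‖ := by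
        refine (norm_add_le _ _).trans_eq ?_
        rw [norm_smul, Real.norm_eq_abs, ContinuousLinearMap.norm_smulRight_apply]
    _ ≤ 1 * A + ‖fderiv ℝ χ v‖ * (A * ‖v‖) := by gcongr
    _ = A + (‖v‖ * ‖fderiv ℝ χ v‖) * A := by ring
    _ ≤ A + D * A := by gcongr
    _ = (1 + D) * A := by ring

lemma exists_norm_mul_norm_fderiv_le {χ : V → W} (hχ : ContDiff ℝ 1 χ) (hc : HasCompactSupport χ) :
    ∃ D : ℝ≥0, ∀ v, ‖v‖ * ‖fderiv ℝ χ v‖ ≤ D := by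
  have hcont : Continuous fun v => ‖v‖ * ‖fderiv ℝ χ v‖ :=
    continuous_norm.mul (hχ.continuous_fderiv one_ne_zero).norm
  obtain ⟨D, hD⟩ := (hc.fderiv ℝ).norm.mul_left.exists_bound_of_continuous hcont
  refine ⟨D.toNNReal, fun v => ?_⟩
  exact (le_abs_self _).trans ((hD v).trans (Real.le_coe_toNNReal D))

lemma add_rpow_sub_one_le_mul_of_le {t b r : ℝ} (ht : 0 ≤ t) (htb : t ≤ b) (hr : 2 ≤ r) :
    t + t ^ (r - 1) ≤ (1 + b ^ (r - 2)) * t := by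
  rcases ht.eq_or_lt with rfl | ht
  · simp [Real.zero_rpow (by linarith : r - 1 ≠ 0)]
  · have hsplit : t ^ (r - 1) = t ^ (r - 2) * t := by
      rw [← Real.rpow_add_one ht.ne']; ring_nf
    rw [hsplit, one_add_mul]
    gcongr

lemma add_rpow_sub_one_le_two_mul {t r : ℝ} (ht : 1 ≤ t) (hr : 2 ≤ r) :
    t + t ^ (r - 1) ≤ 2 * t ^ (r - 1) := by
  linarith [Real.self_le_rpow_of_one_le ht (by linarith : 1 ≤ r - 1)]

lemma exists_norm_fderiv_cutoff_smul_le {χ : V → ℝ} {F : V → W} {g : ℝ → ℝ} (hχ : ContDiff ℝ 1 χ)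
    (hc : HasCompactSupport χ) (hχ01 : ∀ v, χ v ∈ Set.Icc 0 1) (hg : MonotoneOn g (Set.Ici 0))
    (hF : Differentiable ℝ F) (hF0 : F 0 = 0) (hle : ∀ v, ‖fderiv ℝ F v‖ ≤ g ‖v‖) :
    ∃ D : ℝ≥0, (∀ v, ‖fderiv ℝ (fun x => χ x • F x) v‖ ≤ D * g ‖v‖) ∧
      ∀ v, ‖fderiv ℝ (fun x => (1 - χ x) • F x) v‖ ≤ D * g ‖v‖ := by
  obtain ⟨D, hD⟩ := exists_norm_mul_norm_fderiv_le hχ hc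
  have hFv := norm_le_mul_norm_of_norm_fderiv_le hg hF hF0 hle
  have hχd : Differentiable ℝ χ := hχ.differentiable one_ne_zero
  refine ⟨1 + D, fun v => ?_, fun v => ?_⟩
  · refine norm_fderiv_smul_le (hχd v) (hF v) ?_ (hD v) (hFv v) (hle v)
    exact abs_le.2 ⟨by linarith [(hχ01 v).1], (hχ01 v).2⟩
  · refine norm_fderiv_smul_le ((hχd v).const_sub 1) (hF v) ?_ ?_ (hFv v) (hle v)
    · exact abs_le.2 ⟨by linarith [(hχ01 v).2], by linarith [(hχ01 v).1]⟩
    · rw [fderiv_const_sub, norm_neg]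
      exact hD v

lemma norm_fderiv_le_mul_norm_of_eq_zero {G : V → W} {A b : ℝ≥0} {r : ℝ} (hr : 2 ≤ r)
    (hzero : ∀ v, b < ‖v‖ → G v = 0)
    (hle : ∀ v, ‖fderiv ℝ G v‖ ≤ A * (‖v‖ + ‖v‖ ^ (r - 1))) (v : V) :
    ‖fderiv ℝ G v‖ ≤ A * (1 + b ^ (r - 2)) * ‖v‖ := by
  rcases le_or_gt ‖v‖ b with hv | hv
  · refine (hle v).trans ?_
    rw [mul_assoc]
    gcongr
    exact add_rpow_sub_one_le_mul_of_le (norm_nonneg v) hv hr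
  · have hG : G =ᶠ[𝓝 v] 0 := by
      filter_upwards [(isOpen_lt continuous_const continuous_norm).mem_nhds hv] using hzero
    rw [hG.fderiv_eq, fderiv_zero, Pi.zero_apply, norm_zero]
    positivity

lemma norm_fderiv_le_mul_rpow_of_eq_zero {G : V → W} {A : ℝ≥0} {r : ℝ} (hr : 2 ≤ r)
    (hzero : ∀ v, ‖v‖ < 1 → G v = 0)
    (hle : ∀ v, ‖fderiv ℝ G v‖ ≤ A * (‖v‖ + ‖v‖ ^ (r - 1))) (v : V) :
    ‖fderiv ℝ G v‖ ≤ A * 2 * ‖v‖ ^ (r - 1) := by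
  rcases le_or_gt 1 ‖v‖ with hv | hv
  · refine (hle v).trans ?_
    rw [mul_assoc]
    gcongr
    exact add_rpow_sub_one_le_two_mul hv hr
  · have hG : G =ᶠ[𝓝 v] 0 := by
      filter_upwards [(isOpen_lt continuous_norm continuous_const).mem_nhds hv] using hzero
    rw [hG.fderiv_eq, fderiv_zero, Pi.zero_apply, norm_zero]
    positivity

variable [FiniteDimensional ℝ V] [HasContDiffBump V]

lemma exists_add_of_norm_fderiv_le_add_rpow {F : V → W} {K : ℝ≥0} {r : ℝ} (hF : ContDiff ℝ 1 F)
    (hF0 : F 0 = 0) (hr : 2 ≤ r) (hK : ∀ v, ‖fderiv ℝ F v‖ ≤ K * (‖v‖ + ‖v‖ ^ (r - 1))) :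
    ∃ (F₁ F₂ : V → W) (K₁ K₂ : ℝ≥0), F = F₁ + F₂ ∧ ContDiff ℝ 1 F₁ ∧ ContDiff ℝ 1 F₂ ∧
      F₁ 0 = 0 ∧ F₂ 0 = 0 ∧ (∀ v, ‖fderiv ℝ F₁ v‖ ≤ K₁ * ‖v‖) ∧
      ∀ v, ‖fderiv ℝ F₂ v‖ ≤ K₂ * ‖v‖ ^ (r - 1) := by
  let χ : ContDiffBump (0 : V) := ⟨1, 2, one_pos, one_lt_two⟩
  have hχ : ContDiff ℝ 1 χ := χ.contDiff
  have hmono : MonotoneOn (fun t : ℝ => K * (t + t ^ (r - 1))) (Set.Ici 0) :=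
    fun a (ha : 0 ≤ a) b _ hab => by dsimp only; gcongr; linarith
  obtain ⟨D, h₁, h₂⟩ := exists_norm_fderiv_cutoff_smul_le hχ χ.hasCompactSupport
    (fun v => ⟨χ.nonneg, χ.le_one⟩) hmono (hF.differentiable one_ne_zero) hF0 hK
  simp only [← mul_assoc, ← NNReal.coe_mul] at h₁ h₂
  refine ⟨fun v => χ v • F v, fun v => (1 - χ v) • F v, D * K * (1 + 2 ^ (r - 2)), D * K * 2,
    ?_, hχ.smul hF, (contDiff_const.sub hχ).smul hF, by simp [hF0], by simp [hF0],
    norm_fderiv_le_mul_norm_of_eq_zero (b := 2) hr (fun v hv => ?_) h₁,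
    norm_fderiv_le_mul_rpow_of_eq_zero hr (fun v hv => ?_) h₂⟩
  · ext v
    simp only [Pi.add_apply, ← add_smul, add_sub_cancel, one_smul]
  · rw [χ.zero_of_le_dist (x := v) (by simpa using hv.le), zero_smul]
  · rw [χ.one_of_mem_closedBall (x := v) (by simpa using hv.le), sub_self, zero_smul]

end GrowthSplitting

section PowerNorms

variable {α : Type*} {mα : MeasurableSpace α} {μ : Measure α} {f : α → ℝ} {M : ℝ≥0∞} {C : ℝ≥0}

lemma eLpNorm_pow (f : α → ℝ) (p : ℝ≥0∞) {n : ℕ} (hn : n ≠ 0) :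
    eLpNorm (fun x => f x ^ n) p μ = eLpNorm f (p * n) μ ^ n := by
  have hn' : (0 : ℝ) < n := by exact_mod_cast hn.bot_lt
  rw [← eLpNorm_norm]
  simp_rw [norm_pow, ← Real.rpow_natCast]
  rw [eLpNorm_norm_rpow f hn', ENNReal.ofReal_natCast, ENNReal.rpow_natCast]

lemma eLpNorm_pow_le_factorial (h₀ : eLpNorm f 2 μ ≤ M)
    (hstep : ∀ n : ℕ, eLpNorm (fun x => f x ^ (n + 2)) 2 μ
      ≤ C * (n + 2 : ℕ) * M * eLpNorm (fun x => f x ^ (n + 1)) 2 μ) (n : ℕ) :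
    eLpNorm (fun x => f x ^ (n + 1)) 2 μ ≤ (C ^ n * (n + 1).factorial : ℝ≥0) * M ^ (n + 1) := by
  induction n with
  | zero => simpa using h₀
  | succ n ih =>
    refine (hstep n).trans ((mul_le_mul_right ih _).trans_eq ?_)
    rw [Nat.factorial_succ (n + 1)]
    push_cast
    ring

lemma eLpNorm_le_of_eLpNorm_pow_le {p : ℝ≥0∞} {n : ℕ} (hn : n ≠ 0)
    (h : eLpNorm (fun x => f x ^ n) p μ ≤ C * M ^ n) :
    eLpNorm f (p * n) μ ≤ (max 1 C : ℝ≥0) * M := by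
  have hC : (C : ℝ≥0∞) ≤ (max 1 C : ℝ≥0) ^ n := by
    exact_mod_cast (le_max_right 1 C).trans (le_self_pow₀ (le_max_left 1 C) hn)
  rw [eLpNorm_pow f p hn] at h
  rw [← ENNReal.pow_le_pow_left_iff hn, mul_pow]
  exact h.trans (by gcongr)

end PowerNorms

section SobolevInequality

variable {E : Type*} [NormedAddCommGroup E] [NormedSpace ℝ E] [MeasurableSpace E]
  {μ : Measure E} {f : E → ℝ}

/-- The Sobolev inequality `‖f‖_{L^s} ≤ C (‖f‖_{L²} + ‖∇f‖_{L²})`, for test functions `f`. -/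
def SobolevInequality (μ : Measure E) (s : ℝ≥0∞) : Prop :=
  ∃ C : ℝ≥0, ∀ f : E → ℝ, ContDiff ℝ 1 f → HasCompactSupport f →
    eLpNorm f s μ ≤ C * (eLpNorm f 2 μ + eLpNorm (fderiv ℝ f) 2 μ)

lemma sobolevInequality_of_step {C : ℝ≥0}
    (hstep : ∀ f : E → ℝ, ContDiff ℝ 1 f → HasCompactSupport f → ∀ n : ℕ,
      eLpNorm (fun x => f x ^ (n + 2)) 2 μ ≤ C * (n + 2 : ℕ) *
        (eLpNorm f 2 μ + eLpNorm (fderiv ℝ f) 2 μ) * eLpNorm (fun x => f x ^ (n + 1)) 2 μ)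
    (n : ℕ) : SobolevInequality μ (2 * (n + 1 : ℕ)) :=
  ⟨max 1 (C ^ n * (n + 1).factorial), fun f hf hc =>
    eLpNorm_le_of_eLpNorm_pow_le n.succ_ne_zero
      (eLpNorm_pow_le_factorial le_self_add (hstep f hf hc) n)⟩

variable [FiniteDimensional ℝ E] [BorelSpace E]

lemma eLpNorm_one_fderiv_pow_le (hf : ContDiff ℝ 1 f) (n : ℕ) :
    eLpNorm (fderiv ℝ (fun x => f x ^ (n + 1))) 1 μ
      ≤ (n + 1 : ℕ) * (eLpNorm (fderiv ℝ f) 2 μ * eLpNorm (fun x => f x ^ n) 2 μ) := by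
  have hderiv : fderiv ℝ (fun x => f x ^ (n + 1))
      = (n + 1 : ℕ) • ((fun x => f x ^ n) • fderiv ℝ f) := by
    ext1 x
    rw [fderiv_fun_pow (n + 1) (hf.differentiable one_ne_zero x), Nat.add_sub_cancel, smul_assoc]
    rfl
  rw [hderiv, eLpNorm_nsmul, mul_comm (eLpNorm (fderiv ℝ f) 2 μ)]
  gcongr
  exact eLpNorm_smul_le_mul_eLpNorm (hf.continuous_fderiv one_ne_zero).aestronglyMeasurable
    (hf.continuous.pow n).aestronglyMeasurable

lemma sobolevInequality_of_finrank_eq_two [μ.IsAddHaarMeasure] (hE : Module.finrank ℝ E = 2)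
    (n : ℕ) : SobolevInequality μ (2 * (n + 1 : ℕ)) := by
  refine sobolevInequality_of_step (C := eLpNormLESNormFDerivOneConst μ 2)
    (fun f hf hc n => ?_) n
  have hcp : HasCompactSupport (fun x => f x ^ (n + 2)) :=
    hc.comp_left (g := fun t : ℝ => t ^ (n + 2)) (by simp)
  have hp : NNReal.HolderConjugate (Module.finrank ℝ E) 2 := by
    simpa [hE] using NNReal.HolderConjugate.two_two
  calc eLpNorm (fun x => f x ^ (n + 2)) 2 μ
      ≤ eLpNormLESNormFDerivOneConst μ 2 * eLpNorm (fderiv ℝ (fun x => f x ^ (n + 2))) 1 μ :=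
        eLpNorm_le_eLpNorm_fderiv_one μ (hf.pow (n + 2)) hcp hp
    _ ≤ eLpNormLESNormFDerivOneConst μ 2 * ((n + 2 : ℕ) *
          ((eLpNorm f 2 μ + eLpNorm (fderiv ℝ f) 2 μ) * eLpNorm (fun x => f x ^ (n + 1)) 2 μ)) := by
        gcongr
        exact (eLpNorm_one_fderiv_pow_le hf (n + 1)).trans (by gcongr; exact le_add_self)
    _ = _ := by ring

lemma sobolevInequality_of_two_lt_finrank [μ.IsAddHaarMeasure] (hE : 2 < Module.finrank ℝ E) :
    SobolevInequality μ (ENNReal.ofReal (2 * Module.finrank ℝ E / (Module.finrank ℝ E - 2))) := by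
  have hE' : (2 : ℝ) < Module.finrank ℝ E := by exact_mod_cast hE
  have hr : (0 : ℝ) ≤ 2 * Module.finrank ℝ E / (Module.finrank ℝ E - 2) :=
    div_nonneg (by positivity) (by linarith)
  refine ⟨SNormLESNormFDerivOfEqConst ℝ μ (2 : ℝ≥0), fun f hf hc => ?_⟩
  have hgns := eLpNorm_le_eLpNorm_fderiv_of_eq μ hf hc (p := 2)
    (p' := (2 * Module.finrank ℝ E / (Module.finrank ℝ E - 2) : ℝ).toNNReal)
    one_le_two (by omega) (by
      have : (Module.finrank ℝ E : ℝ) - 2 ≠ 0 := by linarith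
      simp only [Real.coe_toNNReal _ hr, NNReal.coe_inv, NNReal.coe_ofNat]
      field_simp)
  exact hgns.trans (by gcongr; exact le_add_self)

end SobolevInequality

section DimensionOne

lemma enorm_le_eLpNorm_one_fderiv {f : Eucl 1 → ℝ} (hf : ContDiff ℝ 1 f)
    (hc : HasCompactSupport f) (x : Eucl 1) : ‖f x‖ₑ ≤ eLpNorm (fderiv ℝ f) 1 volume := by
  let e : ℝ ≃ₗᵢ[ℝ] Eucl 1 := (OrthonormalBasis.singleton (Fin 1) ℝ).repr
  have hderiv : ∀ s, HasDerivAt (f ∘ e) (fderiv ℝ f (e s) (e 1)) s := fun s =>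
    (hf.differentiable one_ne_zero (e s)).hasFDerivAt.comp_hasDerivAt s
      (by simpa using (e.toContinuousLinearEquiv.hasFDerivAt (x := s)).hasDerivAt)
  obtain ⟨t, rfl⟩ := e.surjective x
  calc ‖f (e t)‖ₑ ≤ ∫⁻ s in Set.Iic t, ‖deriv (f ∘ e) s‖ₑ :=
        HasCompactSupport.enorm_le_lintegral_Ici_deriv (hf.comp e.contDiff)
          (hc.comp_homeomorph e.toHomeomorph) t
    _ ≤ ∫⁻ s, ‖deriv (f ∘ e) s‖ₑ := setLIntegral_le_lintegral _ _
    _ ≤ ∫⁻ s, ‖fderiv ℝ f (e s)‖ₑ := by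
        refine lintegral_mono fun s => ?_
        rw [(hderiv s).deriv]
        exact (ContinuousLinearMap.le_opENorm _ _).trans_eq (by simp)
    _ = ∫⁻ y, ‖fderiv ℝ f y‖ₑ :=
        e.measurePreserving.lintegral_comp (hf.continuous_fderiv one_ne_zero).enorm.measurable
    _ = eLpNorm (fderiv ℝ f) 1 volume := eLpNorm_one_eq_lintegral_enorm.symm

lemma enorm_le_eLpNorm_add_eLpNorm_fderiv {f : Eucl 1 → ℝ} (hf : ContDiff ℝ 1 f)
    (hc : HasCompactSupport f) (x : Eucl 1) :
    ‖f x‖ₑ ≤ eLpNorm f 2 volume + eLpNorm (fderiv ℝ f) 2 volume := by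
  have hc2 : HasCompactSupport (fun x => f x ^ 2) :=
    hc.comp_left (g := fun t : ℝ => t ^ 2) (by simp)
  set A := eLpNorm f 2 volume
  set B := eLpNorm (fderiv ℝ f) 2 volume
  rw [← ENNReal.pow_le_pow_left_iff two_ne_zero]
  calc ‖f x‖ₑ ^ 2 = ‖f x ^ 2‖ₑ := (enorm_pow _ _).symm
    _ ≤ eLpNorm (fderiv ℝ (fun x => f x ^ 2)) 1 volume :=
        enorm_le_eLpNorm_one_fderiv (hf.pow 2) hc2 x
    _ ≤ 2 * (B * A) := by simpa using eLpNorm_one_fderiv_pow_le (μ := volume) hf 1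
    _ ≤ 2 * (B * A) + (A ^ 2 + B ^ 2) := le_self_add
    _ = (A + B) ^ 2 := by ring

lemma sobolevInequality_one (n : ℕ) :
    SobolevInequality (volume : Measure (Eucl 1)) (2 * (n + 1 : ℕ)) := by
  refine sobolevInequality_of_step (C := 1) (fun f hf hc n => ?_) n
  set M := eLpNorm f 2 volume + eLpNorm (fderiv ℝ f) 2 volume
  have htop : eLpNorm f ⊤ volume ≤ M :=
    eLpNormEssSup_le_of_ae_enorm_bound
      (ae_of_all _ (enorm_le_eLpNorm_add_eLpNorm_fderiv hf hc))
  calc eLpNorm (fun x => f x ^ (n + 2)) 2 volume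
      = eLpNorm (f • fun x => f x ^ (n + 1)) 2 volume := by
        congr 1 with x
        exact pow_succ' _ _
    _ ≤ eLpNorm f ⊤ volume * eLpNorm (fun x => f x ^ (n + 1)) 2 volume :=
        eLpNorm_smul_le_eLpNorm_top_mul_eLpNorm 2
          (hf.continuous.pow (n + 1)).aestronglyMeasurable f
    _ ≤ M * eLpNorm (fun x => f x ^ (n + 1)) 2 volume := by gcongr
    _ ≤ (1 : ℝ≥0) * (n + 2 : ℕ) * M * eLpNorm (fun x => f x ^ (n + 1)) 2 volume := by
        rw [ENNReal.coe_one, one_mul]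
        gcongr
        exact le_mul_of_one_le_left' (by exact_mod_cast Nat.le_add_left 1 (n + 1))

end DimensionOne

lemma exists_le_sobolevInequality {N : ℕ} (hN : 1 ≤ N) {q : ℝ}
    (hq : (q : EReal) < criticalExponent N) :
    ∃ r, q ≤ r ∧ SobolevInequality (volume : Measure (Eucl N)) (ENNReal.ofReal r) := by
  rcases le_or_gt N 2 with hN2 | hN2
  · obtain ⟨n, hn⟩ := exists_nat_ge q
    have hr : ENNReal.ofReal (2 * (n + 1 : ℕ)) = 2 * (n + 1 : ℕ) := by
      rw [ENNReal.ofReal_mul zero_le_two, ENNReal.ofReal_ofNat, ENNReal.ofReal_natCast]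
    refine ⟨2 * (n + 1 : ℕ), by push_cast; linarith [n.cast_nonneg (α := ℝ)], hr ▸ ?_⟩
    interval_cases N
    · exact sobolevInequality_one n
    · exact sobolevInequality_of_finrank_eq_two finrank_euclideanSpace_fin n
  · rw [criticalExponent, if_neg hN2.not_ge, EReal.coe_lt_coe_iff] at hq
    refine ⟨_, hq.le, ?_⟩
    simpa using sobolevInequality_of_two_lt_finrank (μ := (volume : Measure (Eucl N)))
      (by simpa using hN2)

section YoungConvolution

open scoped Convolution

variable {α W : Type*} [NormedAddCommGroup W]

lemma lintegral_enorm_rpow_le [MeasurableSpace α] {ν : Measure α} [IsProbabilityMeasure ν]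
    {f : α → W} (hf : AEStronglyMeasurable f ν) {p : ℝ≥0∞} (hp1 : 1 ≤ p) (hp : p ≠ ⊤) :
    (∫⁻ x, ‖f x‖ₑ ∂ν) ^ p.toReal ≤ ∫⁻ x, ‖f x‖ₑ ^ p.toReal ∂ν := by
  have hp0 : p ≠ 0 := (zero_lt_one.trans_le hp1).ne'
  have h := eLpNorm_le_eLpNorm_of_exponent_le hp1 hf
  rw [eLpNorm_one_eq_lintegral_enorm, eLpNorm_eq_lintegral_rpow_enorm_toReal hp0 hp] at h
  simpa [ENNReal.toReal_pos hp0 hp] using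
    (ENNReal.le_rpow_inv_iff (ENNReal.toReal_pos hp0 hp)).1 (by simpa using h)

variable {G : Type*} [AddCommGroup G] [MeasurableSpace G] [MeasurableAdd₂ G] [MeasurableNeg G]
  {μ : Measure G} [SFinite μ] [μ.IsAddRightInvariant] [NormedSpace ℝ W]
  {ψ : G → ℝ} {g : G → W} {p : ℝ≥0∞}

lemma enorm_convolution_rpow_le (hψ : AEMeasurable ψ μ) (hψ1 : ∫⁻ x, ‖ψ x‖ₑ ∂μ = 1)
    (hg : AEStronglyMeasurable g μ) (hp1 : 1 ≤ p) (hp : p ≠ ⊤) (x : G) :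
    ‖(ψ ⋆[ContinuousLinearMap.lsmul ℝ ℝ, μ] g) x‖ₑ ^ p.toReal
      ≤ ∫⁻ t, ‖ψ t‖ₑ * ‖g (x - t)‖ₑ ^ p.toReal ∂μ := by
  let ν : Measure G := μ.withDensity fun t => ‖ψ t‖ₑ
  have : IsProbabilityMeasure ν := ⟨by simpa [ν] using hψ1⟩
  have hgx : AEStronglyMeasurable (fun t => g (x - t)) μ :=
    hg.comp_quasiMeasurePreserving (quasiMeasurePreserving_sub_left_of_right_invariant μ x)
  have hν (r : ℝ) : ∫⁻ t, ‖g (x - t)‖ₑ ^ r ∂ν = ∫⁻ t, ‖ψ t‖ₑ * ‖g (x - t)‖ₑ ^ r ∂μ :=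
    lintegral_withDensity_eq_lintegral_mul₀ hψ.enorm (hgx.enorm.pow_const r)
  calc ‖(ψ ⋆[ContinuousLinearMap.lsmul ℝ ℝ, μ] g) x‖ₑ ^ p.toReal
      ≤ (∫⁻ t, ‖ψ t‖ₑ * ‖g (x - t)‖ₑ ∂μ) ^ p.toReal := by
        gcongr
        refine (enorm_integral_le_lintegral_enorm _).trans_eq ?_
        simp [enorm_smul]
    _ = (∫⁻ t, ‖g (x - t)‖ₑ ∂ν) ^ p.toReal := by
        simpa using congrArg (· ^ p.toReal) (hν 1).symm
    _ ≤ ∫⁻ t, ‖g (x - t)‖ₑ ^ p.toReal ∂ν :=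
        lintegral_enorm_rpow_le (hgx.mono_ac (withDensity_absolutelyContinuous _ _)) hp1 hp
    _ = _ := hν p.toReal

lemma eLpNorm_convolution_le (hψ : AEMeasurable ψ μ) (hψ1 : ∫⁻ x, ‖ψ x‖ₑ ∂μ = 1)
    (hg : AEStronglyMeasurable g μ) (hp1 : 1 ≤ p) (hp : p ≠ ⊤) :
    eLpNorm (ψ ⋆[ContinuousLinearMap.lsmul ℝ ℝ, μ] g) p μ ≤ eLpNorm g p μ := by
  have hp0 : p ≠ 0 := (zero_lt_one.trans_le hp1).ne'
  have hgm : AEMeasurable (fun z : G × G => ‖g (z.1 - z.2)‖ₑ ^ p.toReal) (μ.prod μ) :=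
    (hg.comp_quasiMeasurePreserving
      (quasiMeasurePreserving_sub_of_right_invariant μ μ)).enorm.pow_const _
  rw [eLpNorm_eq_lintegral_rpow_enorm_toReal hp0 hp, eLpNorm_eq_lintegral_rpow_enorm_toReal hp0 hp]
  gcongr ?_ ^ _
  calc ∫⁻ x, ‖(ψ ⋆[ContinuousLinearMap.lsmul ℝ ℝ, μ] g) x‖ₑ ^ p.toReal ∂μ
      ≤ ∫⁻ x, ∫⁻ t, ‖ψ t‖ₑ * ‖g (x - t)‖ₑ ^ p.toReal ∂μ ∂μ :=
        lintegral_mono (enorm_convolution_rpow_le hψ hψ1 hg hp1 hp)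
    _ = ∫⁻ t, ∫⁻ x, ‖ψ t‖ₑ * ‖g (x - t)‖ₑ ^ p.toReal ∂μ ∂μ :=
        lintegral_lintegral_swap (hψ.enorm.comp_snd.mul hgm)
    _ = ∫⁻ t, ‖ψ t‖ₑ * ∫⁻ x, ‖g x‖ₑ ^ p.toReal ∂μ ∂μ := by
        refine lintegral_congr fun t => ?_
        rw [lintegral_const_mul' _ _ enorm_ne_top,
          lintegral_sub_right_eq_self (fun x => ‖g x‖ₑ ^ p.toReal) t]
    _ = ∫⁻ x, ‖g x‖ₑ ^ p.toReal ∂μ := by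
        rw [lintegral_mul_const'' _ hψ.enorm, hψ1, one_mul]

end YoungConvolution

section Cutoff

variable {E : Type*} [NormedAddCommGroup E] [NormedSpace ℝ E]

lemma eLpNorm_fderiv_mul_le [MeasurableSpace E] [BorelSpace E] [FiniteDimensional ℝ E]
    {μ : Measure E} {χ f : E → ℝ} {p : ℝ≥0∞} {D : ℝ≥0} (hp : 1 ≤ p) (hχ : ContDiff ℝ 1 χ)
    (hχ1 : ∀ x, ‖χ x‖ₑ ≤ 1) (hχD : ∀ x, ‖fderiv ℝ χ x‖ₑ ≤ D) (hf : ContDiff ℝ 1 f) :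
    eLpNorm (fderiv ℝ (χ * f)) p μ ≤ eLpNorm (fderiv ℝ f) p μ + D * eLpNorm f p μ := by
  have hderiv : fderiv ℝ (χ * f) = χ • fderiv ℝ f + f • fderiv ℝ χ := by
    ext1 x
    exact fderiv_mul (hχ.differentiable one_ne_zero x) (hf.differentiable one_ne_zero x)
  have hχ' := hχ.continuous_fderiv one_ne_zero
  have hf' := hf.continuous_fderiv one_ne_zero
  rw [hderiv]
  refine (eLpNorm_add_le (hχ.continuous.smul hf').aestronglyMeasurable
    (hf.continuous.smul hχ').aestronglyMeasurable hp).trans (add_le_add ?_ ?_)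
  · refine eLpNorm_mono_enorm fun x => ?_
    rw [Pi.smul_apply', enorm_smul]
    exact mul_le_of_le_one_left' (hχ1 x)
  · calc eLpNorm (f • fderiv ℝ χ) p μ ≤ eLpNorm ((D : ℝ) • f) p μ := by
          refine eLpNorm_mono_enorm fun x => ?_
          rw [Pi.smul_apply', Pi.smul_apply, enorm_smul, enorm_smul, mul_comm]
          gcongr
          simpa [Real.enorm_eq_ofReal] using hχD x
      _ = D * eLpNorm f p μ := by
          rw [eLpNorm_const_smul, Real.enorm_eq_ofReal D.coe_nonneg, ENNReal.ofReal_coe_nnreal]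

/-- The dilates by `n + 1` of a fixed bump function: smooth cutoffs which exhaust the space and
whose derivatives are bounded uniformly in `n`. -/
def cutoff (E : Type*) [NormedAddCommGroup E] [NormedSpace ℝ E] [HasContDiffBump E] (n : ℕ)
    (x : E) : ℝ :=
  (⟨1, 2, one_pos, one_lt_two⟩ : ContDiffBump (0 : E)) (((n : ℝ) + 1)⁻¹ • x)

variable [HasContDiffBump E]

lemma contDiff_cutoff (n : ℕ) : ContDiff ℝ 1 (cutoff E n) :=
  (ContDiffBump.contDiff _).comp (contDiff_const_smul _)

lemma hasCompactSupport_cutoff [FiniteDimensional ℝ E] (n : ℕ) :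
    HasCompactSupport (cutoff E n) :=
  (ContDiffBump.hasCompactSupport _).comp_homeomorph
    (Homeomorph.smulOfNeZero ((n : ℝ) + 1)⁻¹ (by positivity))

lemma enorm_cutoff_le_one (n : ℕ) (x : E) : ‖cutoff E n x‖ₑ ≤ 1 := by
  rw [cutoff, Real.enorm_of_nonneg (ContDiffBump.nonneg _), ENNReal.ofReal_le_one]
  exact ContDiffBump.le_one _

lemma exists_enorm_fderiv_cutoff_le [FiniteDimensional ℝ E] :
    ∃ D : ℝ≥0, ∀ (n : ℕ) (x : E), ‖fderiv ℝ (cutoff E n) x‖ₑ ≤ D := by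
  let b : ContDiffBump (0 : E) := ⟨1, 2, one_pos, one_lt_two⟩
  have hb : ContDiff ℝ 1 b := b.contDiff
  obtain ⟨D, hD⟩ := (hb.continuous_fderiv one_ne_zero).bounded_above_of_compact_support
    (b.hasCompactSupport.fderiv ℝ)
  refine ⟨D.toNNReal, fun n x => ?_⟩
  have hderiv : fderiv ℝ (cutoff E n) x
      = ((n : ℝ) + 1)⁻¹ • fderiv ℝ b (((n : ℝ) + 1)⁻¹ • x) := fderiv_comp_smul _
  have hinv : ‖((n : ℝ) + 1)⁻¹‖ ≤ 1 := by
    rw [Real.norm_of_nonneg (by positivity)]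
    exact inv_le_one_of_one_le₀ (by linarith [n.cast_nonneg (α := ℝ)])
  rw [hderiv, ← ofReal_norm, norm_smul]
  exact ENNReal.ofReal_le_ofReal ((mul_le_of_le_one_left (norm_nonneg _) hinv).trans (hD _))

lemma eventually_cutoff_eq_one (x : E) : ∀ᶠ n in atTop, cutoff E n x = 1 := by
  filter_upwards [eventually_ge_atTop ⌈‖x‖⌉₊] with n hn
  refine ContDiffBump.one_of_mem_closedBall _ ?_
  rw [mem_closedBall_zero_iff, norm_smul, Real.norm_of_nonneg (by positivity),
    inv_mul_le_iff₀ (by positivity), mul_one]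
  exact (Nat.ceil_le.1 hn).trans (by linarith)

lemma SobolevInequality.exists_forall_contDiff_le [MeasurableSpace E] [BorelSpace E]
    [FiniteDimensional ℝ E] {μ : Measure E} {s : ℝ≥0∞} (h : SobolevInequality μ s) :
    ∃ C : ℝ≥0, ∀ f : E → ℝ, ContDiff ℝ 1 f →
      eLpNorm f s μ ≤ C * (eLpNorm f 2 μ + eLpNorm (fderiv ℝ f) 2 μ) := by
  obtain ⟨C, hC⟩ := h
  obtain ⟨D, hD⟩ := exists_enorm_fderiv_cutoff_le (E := E)
  refine ⟨C * (1 + D), fun f hf => ?_⟩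
  refine Lp.eLpNorm_le_of_ae_tendsto (u := atTop) (f := fun n => cutoff E n * f)
    (Eventually.of_forall fun n => ?_)
    (fun n => ((contDiff_cutoff n).continuous.mul hf.continuous).aestronglyMeasurable)
    (ae_of_all _ fun x => ?_)
  · have hmul : eLpNorm (cutoff E n * f) 2 μ ≤ eLpNorm f 2 μ := by
      refine eLpNorm_mono_enorm fun x => ?_
      rw [Pi.mul_apply, enorm_mul]
      exact mul_le_of_le_one_left' (enorm_cutoff_le_one n x)
    calc eLpNorm (cutoff E n * f) s μ
        ≤ C * (eLpNorm (cutoff E n * f) 2 μ + eLpNorm (fderiv ℝ (cutoff E n * f)) 2 μ) :=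
          hC _ ((contDiff_cutoff n).mul hf) (hasCompactSupport_cutoff n).mul_right
      _ ≤ C * (eLpNorm f 2 μ + (eLpNorm (fderiv ℝ f) 2 μ + D * eLpNorm f 2 μ)) := by
          gcongr
          exact eLpNorm_fderiv_mul_le one_le_two (contDiff_cutoff n) (enorm_cutoff_le_one n)
            (hD n) hf
      _ ≤ C * (eLpNorm f 2 μ + (eLpNorm (fderiv ℝ f) 2 μ + D * eLpNorm f 2 μ))
            + C * (D * eLpNorm (fderiv ℝ f) 2 μ) := le_self_add
      _ = (C * (1 + D) : ℝ≥0) * (eLpNorm f 2 μ + eLpNorm (fderiv ℝ f) 2 μ) := by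
          push_cast
          ring
  · refine tendsto_const_nhds.congr' ?_
    filter_upwards [eventually_cutoff_eq_one x] with n hn
    rw [Pi.mul_apply, hn, one_mul]

end Cutoff

section Mollification

open scoped Convolution
open ContinuousLinearMap (lsmul)

lemma lintegral_enorm_normed {E : Type*} [NormedAddCommGroup E] [NormedSpace ℝ E]
    [HasContDiffBump E] [MeasurableSpace E] [BorelSpace E] [FiniteDimensional ℝ E] {c : E}
    (φ : ContDiffBump c) (μ : Measure E) [IsLocallyFiniteMeasure μ] [μ.IsOpenPosMeasure] :
    ∫⁻ x, ‖φ.normed μ x‖ₑ ∂μ = 1 := by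
  rw [← ofReal_integral_norm_eq_lintegral_enorm φ.integrable_normed]
  simp only [Real.norm_of_nonneg (φ.nonneg_normed _), φ.integral_normed, ENNReal.ofReal_one]

lemma fderiv_convolution_apply {E : Type*} [NormedAddCommGroup E] [NormedSpace ℝ E]
    [MeasurableSpace E] [BorelSpace E] [FiniteDimensional ℝ E] {μ : Measure E}
    [μ.IsAddHaarMeasure] {ψ u : E → ℝ} (hψ : ContDiff ℝ 1 ψ) (hc : HasCompactSupport ψ)
    (hu : LocallyIntegrable u μ) (x v : E) :
    fderiv ℝ (ψ ⋆[lsmul ℝ ℝ, μ] u) x v = ∫ y, u y * fderiv ℝ ψ (x - y) v ∂μ := by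
  have hex : ConvolutionExistsAt (fderiv ℝ ψ) u x ((lsmul ℝ ℝ).precompL E) μ :=
    (hc.fderiv ℝ).convolutionExists_left _ (hψ.continuous_fderiv one_ne_zero) hu x
  rw [(hc.hasFDerivAt_convolution_left (lsmul ℝ ℝ) hψ hu x).fderiv, convolution_eq_swap,
    ContinuousLinearMap.integral_apply hex.integrable_swap]
  exact integral_congr_ae (ae_of_all _ fun y => by
    simp [ContinuousLinearMap.precompL_apply, mul_comm])

variable {N : ℕ} {ψ : Eucl N → ℝ}

lemma IsWeakPartialDeriv.fderiv_convolution {j : Fin N} {u g : L2 N}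
    (h : IsWeakPartialDeriv j u g) (hψ : ContDiff ℝ ∞ ψ) (hc : HasCompactSupport ψ)
    (x : Eucl N) :
    fderiv ℝ (ψ ⋆[lsmul ℝ ℝ, volume] u) x (EuclideanSpace.single j 1)
      = (ψ ⋆[lsmul ℝ ℝ, volume] g) x := by
  have hreflect : ∀ y, fderiv ℝ (fun y => ψ (x - y)) y (EuclideanSpace.single j 1)
      = -fderiv ℝ ψ (x - y) (EuclideanSpace.single j 1) := fun y => by
    have hderiv : HasFDerivAt (fun y => ψ (x - y)) _ y :=
      ((hψ.differentiable (by simp) (x - y)).hasFDerivAt).comp y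
        ((hasFDerivAt_id y).const_sub x)
    rw [hderiv.fderiv]
    simp
  have htest := h (fun y => ψ (x - y)) (hψ.comp (contDiff_const.sub contDiff_id))
    (hc.comp_homeomorph (Homeomorph.subLeft x))
  simp only [hreflect, mul_neg, integral_neg, neg_inj] at htest
  rw [fderiv_convolution_apply (hψ.of_le (by simp)) hc
    ((Lp.memLp u).locallyIntegrable one_le_two), htest, convolution_lsmul_swap]
  simp only [smul_eq_mul, mul_comm]

lemma enorm_le_sum_enorm_apply_single (L : Eucl N →L[ℝ] ℝ) :
    ‖L‖ₑ ≤ ∑ j, ‖L (EuclideanSpace.single j 1)‖ₑ := by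
  refine L.opENorm_le_bound fun v => ?_
  have hv : L v = ∑ j, v j * L (EuclideanSpace.single j 1) := by
    conv_lhs => rw [← (EuclideanSpace.basisFun (Fin N) ℝ).sum_repr v]
    simp
  rw [hv, Finset.sum_mul]
  refine (enorm_sum_le _ _).trans (Finset.sum_le_sum fun j _ => ?_)
  rw [enorm_mul, mul_comm]
  gcongr
  exact enorm_le_iff_norm_le.2 (PiLp.norm_apply_le v j)

lemma eLpNorm_fderiv_convolution_le (w : sobolevH1 N) (hψ : ContDiff ℝ ∞ ψ)
    (hc : HasCompactSupport ψ) (hψ1 : ∫⁻ x, ‖ψ x‖ₑ = 1) :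
    eLpNorm (fderiv ℝ (ψ ⋆[lsmul ℝ ℝ, volume] w.val.fst)) 2 volume
      ≤ ∑ j, eLpNorm (w.val.snd j) 2 volume := by
  let g : Fin N → Eucl N → ℝ := fun j => ψ ⋆[lsmul ℝ ℝ, volume] w.val.snd j
  have hg : ∀ j, Continuous (g j) := fun j => hc.continuous_convolution_left _ hψ.continuous
    ((Lp.memLp (w.val.snd j)).locallyIntegrable one_le_two)
  calc eLpNorm (fderiv ℝ (ψ ⋆[lsmul ℝ ℝ, volume] w.val.fst)) 2 volume
      ≤ eLpNorm (∑ j, fun x => ‖g j x‖ₑ) 2 volume := by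
        refine eLpNorm_mono_enorm fun x => (enorm_le_sum_enorm_apply_single _).trans_eq ?_
        rw [Finset.sum_apply, enorm_eq_self]
        exact Finset.sum_congr rfl fun j _ => by rw [(w.property j).fderiv_convolution hψ hc]
    _ ≤ ∑ j, eLpNorm (fun x => ‖g j x‖ₑ) 2 volume :=
        eLpNorm_sum_le (fun j _ => (hg j).enorm.aestronglyMeasurable) one_le_two
    _ ≤ ∑ j, eLpNorm (w.val.snd j) 2 volume := by
        refine Finset.sum_le_sum fun j _ => ?_
        rw [eLpNorm_enorm]
        exact eLpNorm_convolution_le hψ.continuous.aemeasurable hψ1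
          (Lp.aestronglyMeasurable _) one_le_two ENNReal.ofNat_ne_top

end Mollification

section Embedding

open scoped Convolution
open ContinuousLinearMap (lsmul)

variable {N : ℕ} {s : ℝ≥0∞}

lemma eLpNorm_fst_le (w : sobolevH1 N) : eLpNorm w.val.fst 2 volume ≤ ‖w‖ₑ := by
  rw [← Lp.enorm_def]
  exact enorm_le_iff_norm_le.2 (WithLp.norm_fst_le _ w.val)

lemma eLpNorm_snd_le (w : sobolevH1 N) (j : Fin N) :
    eLpNorm (w.val.snd j) 2 volume ≤ ‖w‖ₑ := by
  rw [← Lp.enorm_def]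
  exact enorm_le_iff_norm_le.2 ((PiLp.norm_apply_le w.val.snd j).trans (WithLp.norm_snd_le _ w.val))

/-- Smooth nonnegative kernels of mass one, supported in the ball of radius `2 / (n + 1)`. -/
def mollifier (N n : ℕ) : Eucl N → ℝ :=
  (⟨1 / ((n : ℝ) + 1), 2 * (1 / ((n : ℝ) + 1)), by positivity,
    lt_two_mul_self (by positivity)⟩ : ContDiffBump (0 : Eucl N)).normed volume

lemma contDiff_mollifier (N n : ℕ) : ContDiff ℝ ∞ (mollifier N n) :=
  ContDiffBump.contDiff_normed _

lemma hasCompactSupport_mollifier (N n : ℕ) : HasCompactSupport (mollifier N n) :=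
  ContDiffBump.hasCompactSupport_normed _

lemma lintegral_enorm_mollifier (N n : ℕ) : ∫⁻ x, ‖mollifier N n x‖ₑ = 1 :=
  lintegral_enorm_normed _ _

lemma ae_tendsto_mollifier_convolution {u : Eucl N → ℝ} (hu : LocallyIntegrable u) :
    ∀ᵐ x, Tendsto (fun n => (mollifier N n ⋆[lsmul ℝ ℝ, volume] u) x) atTop (𝓝 (u x)) := by
  refine ContDiffBump.ae_convolution_tendsto_right_of_locallyIntegrable (K := 2) ?_
    (Eventually.of_forall fun n => le_rfl) hu
  change Tendsto (fun n : ℕ => 2 * (1 / ((n : ℝ) + 1))) atTop (𝓝 0)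
  simpa using (tendsto_one_div_add_atTop_nhds_zero_nat (𝕜 := ℝ)).const_mul 2

lemma SobolevInequality.exists_eLpNorm_fst_le
    (h : SobolevInequality (volume : Measure (Eucl N)) s) :
    ∃ C : ℝ≥0, ∀ w : sobolevH1 N, eLpNorm w.val.fst s volume ≤ C * ‖w‖ₑ := by
  obtain ⟨C, hC⟩ := h.exists_forall_contDiff_le
  refine ⟨C * (1 + N), fun w => ?_⟩
  have hw : LocallyIntegrable w.val.fst volume :=
    (Lp.memLp w.val.fst).locallyIntegrable one_le_two
  let v : ℕ → Eucl N → ℝ := fun n => mollifier N n ⋆[lsmul ℝ ℝ, volume] w.val.fst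
  have hv : ∀ n, ContDiff ℝ 1 (v n) := fun n =>
    (hasCompactSupport_mollifier N n).contDiff_convolution_left _
      ((contDiff_mollifier N n).of_le (by simp)) hw
  have hv2 : ∀ n, eLpNorm (v n) 2 volume ≤ ‖w‖ₑ := fun n =>
    (eLpNorm_convolution_le (contDiff_mollifier N n).continuous.aemeasurable
      (lintegral_enorm_mollifier N n) (Lp.aestronglyMeasurable _) one_le_two
      ENNReal.ofNat_ne_top).trans (eLpNorm_fst_le w)
  have hdv2 : ∀ n, eLpNorm (fderiv ℝ (v n)) 2 volume ≤ N * ‖w‖ₑ := fun n =>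
    calc eLpNorm (fderiv ℝ (v n)) 2 volume ≤ ∑ j, eLpNorm (w.val.snd j) 2 volume :=
          eLpNorm_fderiv_convolution_le w (contDiff_mollifier N n)
            (hasCompactSupport_mollifier N n) (lintegral_enorm_mollifier N n)
      _ ≤ ∑ _j : Fin N, ‖w‖ₑ := Finset.sum_le_sum fun j _ => eLpNorm_snd_le w j
      _ = N * ‖w‖ₑ := by rw [Finset.sum_const, Finset.card_univ, Fintype.card_fin, nsmul_eq_mul]
  refine Lp.eLpNorm_le_of_ae_tendsto (u := atTop) (f := v) (Eventually.of_forall fun n => ?_)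
    (fun n => (hv n).continuous.aestronglyMeasurable) (ae_tendsto_mollifier_convolution hw)
  calc eLpNorm (v n) s volume
      ≤ C * (eLpNorm (v n) 2 volume + eLpNorm (fderiv ℝ (v n)) 2 volume) := hC _ (hv n)
    _ ≤ C * (‖w‖ₑ + N * ‖w‖ₑ) := by gcongr; exacts [hv2 n, hdv2 n]
    _ = (C * (1 + N) : ℝ≥0) * ‖w‖ₑ := by
        push_cast
        ring

end Embedding

section VectorEmbedding

variable {N k : ℕ} {s : ℝ≥0∞} [Fact (1 ≤ s)]

lemma SobolevInequality.exists_embedding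
    (h : SobolevInequality (volume : Measure (Eucl N)) s) :
    ∃ ι : sobolevH1 N →L[ℝ] Lp ℝ s (volume : Measure (Eucl N)),
      ∀ w, ι w =ᵐ[volume] w.val.fst := by
  obtain ⟨C, hC⟩ := h.exists_eLpNorm_fst_le
  have hmem : ∀ w : sobolevH1 N, MemLp w.val.fst s volume := fun w =>
    ⟨Lp.aestronglyMeasurable _, (hC w).trans_lt (by finiteness)⟩
  let ι : sobolevH1 N →ₗ[ℝ] Lp ℝ s (volume : Measure (Eucl N)) :=
    { toFun := fun w => (hmem w).toLp _
      map_add' := fun v w => by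
        rw [← MemLp.toLp_add, MemLp.toLp_eq_toLp_iff]
        exact Lp.coeFn_add _ _
      map_smul' := fun c w => by
        rw [RingHom.id_apply, ← MemLp.toLp_const_smul, MemLp.toLp_eq_toLp_iff]
        exact Lp.coeFn_smul _ _ }
  refine ⟨ι.mkContinuous C fun w => ?_, fun w => (hmem w).coeFn_toLp⟩
  have hw : ‖ι w‖ₑ ≤ C * ‖w‖ₑ := (Lp.enorm_toLp (hmem w)).trans_le (hC w)
  rw [enorm_eq_nnnorm, enorm_eq_nnnorm] at hw
  exact_mod_cast hw

lemma SobolevInequality.exists_embedding_H1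
    (h : SobolevInequality (volume : Measure (Eucl N)) s) :
    ∃ ι : H1 N k →L[ℝ] Lp (Eucl k) s (volume : Measure (Eucl N)),
      ∀ u, ι u =ᵐ[volume] u.toFun := by
  obtain ⟨ι, hι⟩ := h.exists_embedding
  let e : Fin k → ℝ →L[ℝ] Eucl k := fun i =>
    ContinuousLinearMap.toSpanSingleton ℝ (EuclideanSpace.single i 1)
  refine ⟨∑ i, (e i).compLpL s volume ∘L ι ∘L PiLp.proj 2 _ i, fun u => ?_⟩
  rw [sum_apply]
  filter_upwards [Lp.coeFn_fun_finsetSum Finset.univ fun i => (e i).compLp (ι (u i)),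
    ae_all_iff.2 fun i => (e i).coeFn_compLp (ι (u i)), ae_all_iff.2 fun i => hι (u i)]
    with x hsum hcomp hu
  refine hsum.trans ?_
  simp only [hcomp, hu]
  ext i
  simp [e, H1.toFun, H1.comp, Pi.single_apply]

end VectorEmbedding

-- Shortcut: unification makes the default synthesis of this instance time out.
local instance {N k : ℕ} : NormedSpace ℝ (H1 N k) := PiLp.normedSpace 2 ℝ _

section Nemytski

variable {N k : ℕ} {F : Eucl k → ℝ}

lemma SobolevInequality.exists_differentiable_nemytski {s : ℝ≥0∞}
    (h : SobolevInequality (volume : Measure (Eucl N)) s) (hs1 : 1 < s) (hs : s ≠ ⊤) {K : ℝ≥0}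
    (hF : ContDiff ℝ 1 F) (hF0 : F 0 = 0)
    (hK : ∀ v, ‖fderiv ℝ F v‖ ≤ K * ‖v‖ ^ (s.toReal - 1)) :
    ∃ hint : ∀ u : H1 N k, Integrable (fun x => F (u.toFun x)) volume,
      Differentiable ℝ (nemytski F hint) := by
  have : Fact (1 ≤ s) := ⟨hs1.le⟩
  obtain ⟨ι, hι⟩ := h.exists_embedding_H1 (k := k)
  have hF_Lp : ∀ f : Lp (Eucl k) s (volume : Measure (Eucl N)),
      Integrable (fun x => F (f x)) volume := fun f =>
    integrable_comp hs1 hs hF hF0 hK (Lp.memLp f)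
  have hcomp : ∀ u : H1 N k,
      (fun x => F (ι u x)) =ᵐ[volume] fun x => F (u.toFun x) := fun u => (hι u).fun_comp F
  have hint : ∀ u : H1 N k, Integrable (fun x => F (u.toFun x)) volume := fun u =>
    (hF_Lp (ι u)).congr (hcomp u)
  have hfactor : nemytski F hint = lpNemytski F hF_Lp ∘ ι := funext fun u =>
    (Integrable.toL1_eq_toL1_iff _ _ _ (hF_Lp (ι u))).2 (hcomp u).symm
  exact ⟨hint, hfactor ▸ (differentiable_lpNemytski hs1 hs hF hK hF_Lp).comp ι.differentiable⟩

lemma sobolevInequality_two {E : Type*} [NormedAddCommGroup E] [NormedSpace ℝ E]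
    [MeasurableSpace E] (μ : Measure E) : SobolevInequality μ 2 :=
  ⟨1, fun _ _ _ => by rw [ENNReal.coe_one, one_mul]; exact le_self_add⟩

lemma SobolevInequality.exists_differentiable_nemytski_of_norm_fderiv_le {r : ℝ} (hr : 2 ≤ r)
    (h : SobolevInequality (volume : Measure (Eucl N)) (ENNReal.ofReal r)) {K : ℝ≥0}
    (hF : ContDiff ℝ 1 F) (hF0 : F 0 = 0)
    (hK : ∀ v, ‖fderiv ℝ F v‖ ≤ K * (‖v‖ + ‖v‖ ^ (r - 1))) :
    ∃ hint : ∀ u : H1 N k, Integrable (fun x => F (u.toFun x)) volume,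
      Differentiable ℝ (nemytski F hint) := by
  obtain ⟨F₁, F₂, K₁, K₂, rfl, hF₁, hF₂, hF₁0, hF₂0, hK₁, hK₂⟩ :=
    exists_add_of_norm_fderiv_le_add_rpow hF hF0 hr hK
  have hexp₁ : (2 : ℝ≥0∞).toReal - 1 = 1 := by norm_num
  have hexp₂ : (ENNReal.ofReal r).toReal = r := ENNReal.toReal_ofReal (by linarith)
  obtain ⟨hint₁, hd₁⟩ := (sobolevInequality_two volume).exists_differentiable_nemytski (N := N)
    ENNReal.one_lt_two ENNReal.ofNat_ne_top hF₁ hF₁0 (by simpa only [hexp₁, Real.rpow_one])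
  obtain ⟨hint₂, hd₂⟩ := h.exists_differentiable_nemytski
    (ENNReal.one_lt_ofReal.2 (by linarith)) ENNReal.ofReal_ne_top hF₂ hF₂0 (by simpa only [hexp₂])
  exact ⟨fun u => (hint₁ u).add (hint₂ u), hd₁.add hd₂⟩

end Nemytski

section Energy

variable {N k : ℕ}

lemma differentiable_energy {F : Eucl k → ℝ}
    (hint : ∀ u : H1 N k, Integrable (fun x => F (u.toFun x)) volume)
    (hd : Differentiable ℝ (nemytski F hint)) : Differentiable ℝ (energy (N := N) F) := by
  have hintegral : Differentiable ℝ fun z : H1 N k × Eucl k => ∫ x, F (z.1.toFun x) := by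
    have h : ∀ u : H1 N k, ∫ x, F (u.toFun x) = L1.integralCLM (nemytski F hint u) := fun u => by
      rw [← L1.integral_eq, nemytski, ← integral_eq]
    simp only [h]
    exact L1.integralCLM.differentiable.comp (hd.comp differentiable_fst)
  let pair : Fin k → H1 N k × Eucl k →L[ℝ] WithLp 2 (L2 N × PiLp 2 fun _ : Fin N => L2 N) :=
    fun i => (sobolevH1 N).subtypeL ∘L PiLp.proj 2 _ i ∘L ContinuousLinearMap.fst ℝ _ _
  have hcomp : ∀ i, Differentiable ℝ fun z : H1 N k × Eucl k => ‖z.1.comp i‖ ^ 2 := fun i =>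
    (WithLp.fstL 2 ℝ (L2 N) (PiLp 2 fun _ : Fin N => L2 N) ∘L pair i).differentiable.norm_sq ℝ
  have hgrad : ∀ i, Differentiable ℝ fun z : H1 N k × Eucl k => ‖z.1.grad i‖ ^ 2 := fun i =>
    (WithLp.sndL 2 ℝ (L2 N) (PiLp 2 fun _ : Fin N => L2 N) ∘L pair i).differentiable.norm_sq ℝ
  have hω : ∀ i, Differentiable ℝ fun z : H1 N k × Eucl k => z.2 i := fun i =>
    (EuclideanSpace.proj i ∘L ContinuousLinearMap.snd ℝ (H1 N k) (Eucl k)).differentiable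
  exact (hintegral.add ((Differentiable.fun_sum fun i _ => hgrad i).const_mul _)).add
    ((Differentiable.fun_sum fun i _ => ((hω i).pow 2).mul (hcomp i)).const_mul _)

end Energy

section Growth

lemma rpow_le_self_add_rpow {t a b : ℝ} (ht : 0 ≤ t) (ha : 1 ≤ a) (hab : a ≤ b) :
    t ^ a ≤ t + t ^ b := by
  rcases le_total t 1 with h | h
  · have := Real.rpow_le_rpow_of_exponent_ge_of_imp ht h ha (by intros; linarith)
    rw [Real.rpow_one] at this
    linarith [Real.rpow_nonneg ht b]
  · linarith [Real.rpow_le_rpow_of_exponent_le h hab]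

variable {k : ℕ}

lemma hasFDerivAt_half_sum_sq_mul_sq (m : Fin k → ℝ) (v : Eucl k) :
    HasFDerivAt (fun v : Eucl k => 1 / 2 * ∑ i, m i ^ 2 * |v i| ^ 2)
      (∑ i, (m i ^ 2 * v i) • (EuclideanSpace.proj i : Eucl k →L[ℝ] ℝ)) v := by
  simp only [sq_abs]
  have hproj : ∀ i, HasFDerivAt (fun w : Eucl k => w i)
      (EuclideanSpace.proj i : Eucl k →L[ℝ] ℝ) v := fun i =>
    (EuclideanSpace.proj i : Eucl k →L[ℝ] ℝ).hasFDerivAt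
  refine ((HasFDerivAt.fun_sum fun i _ => ((hproj i).pow 2).const_mul (m i ^ 2)).const_mul
    (1 / 2 : ℝ)).congr_fderiv ?_
  rw [Finset.smul_sum]
  refine Finset.sum_congr rfl fun i _ => ?_
  simp only [smul_smul]
  congr 1
  push_cast
  ring

lemma norm_sum_sq_mul_smul_proj_le (m : Fin k → ℝ) (v : Eucl k) :
    ‖∑ i, (m i ^ 2 * v i) • (EuclideanSpace.proj i : Eucl k →L[ℝ] ℝ)‖
      ≤ (∑ i, m i ^ 2) * ‖v‖ := by
  have hproj : ∀ i, ‖(EuclideanSpace.proj i : Eucl k →L[ℝ] ℝ)‖ ≤ 1 := fun i =>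
    ContinuousLinearMap.opNorm_le_bound _ zero_le_one fun w =>
      (PiLp.norm_apply_le w i).trans_eq (one_mul _).symm
  rw [Finset.sum_mul]
  refine norm_sum_le_of_le _ fun i _ => ?_
  rw [norm_smul, norm_mul, Real.norm_of_nonneg (sq_nonneg (m i)), mul_assoc]
  gcongr
  exact (mul_le_of_le_one_right (norm_nonneg _) (hproj i)).trans (PiLp.norm_apply_le v i)

lemma exists_norm_fderiv_le {m : Fin k → ℝ} {F R : Eucl k → ℝ} (hF : Differentiable ℝ F)
    (hFR : ∀ v, F v = 1 / 2 * ∑ i, m i ^ 2 * |v i| ^ 2 + R v) {p q c c' : ℝ} (hc : 0 ≤ c)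
    (hc' : 0 ≤ c') (hp : 2 ≤ p) (hpq : p ≤ q)
    (hgrowth : ∀ v, ‖gradient R v‖ ≤ c * ‖v‖ ^ (p - 1) + c' * ‖v‖ ^ (q - 1)) :
    ∃ K : ℝ≥0, ∀ v, ‖fderiv ℝ F v‖ ≤ K * (‖v‖ + ‖v‖ ^ (q - 1)) := by
  have hR : R = fun v => F v - 1 / 2 * ∑ i, m i ^ 2 * |v i| ^ 2 :=
    funext fun v => eq_sub_of_add_eq' (hFR v).symm
  have hfderiv : ∀ v, fderiv ℝ F v = fderiv ℝ R v
      + ∑ i, (m i ^ 2 * v i) • (EuclideanSpace.proj i : Eucl k →L[ℝ] ℝ) := fun v => by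
    rw [hR, ((hF v).hasFDerivAt.fun_sub (hasFDerivAt_half_sum_sq_mul_sq m v)).fderiv,
      sub_add_cancel]
  refine ⟨⟨(∑ i, m i ^ 2) + c + c', by positivity⟩, fun v => ?_⟩
  have hnormR : ‖fderiv ℝ R v‖ ≤ c * ‖v‖ ^ (p - 1) + c' * ‖v‖ ^ (q - 1) := by
    simpa only [gradient, LinearIsometryEquiv.norm_map] using hgrowth v
  have hpow := rpow_le_self_add_rpow (norm_nonneg v) (by linarith : 1 ≤ p - 1)
    (by linarith : p - 1 ≤ q - 1)
  calc ‖fderiv ℝ F v‖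
      ≤ (c * ‖v‖ ^ (p - 1) + c' * ‖v‖ ^ (q - 1)) + (∑ i, m i ^ 2) * ‖v‖ := by
        rw [hfderiv]
        exact norm_add_le_of_le hnormR (norm_sum_sq_mul_smul_proj_le m v)
    _ ≤ (c * (‖v‖ + ‖v‖ ^ (q - 1)) + c' * (‖v‖ + ‖v‖ ^ (q - 1)))
          + (∑ i, m i ^ 2) * (‖v‖ + ‖v‖ ^ (q - 1)) := by
        gcongr
        · exact le_add_of_nonneg_left (norm_nonneg v)
        · exact le_add_of_nonneg_right (by positivity)
    _ = ((∑ i, m i ^ 2) + c + c') * (‖v‖ + ‖v‖ ^ (q - 1)) := by ring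

end Growth

end EllipticSystem

end

theorem mainTheorem4_general (N k : ℕ) (hN : 1 ≤ N) (F : EllipticSystem.Eucl k → ℝ)
    (hF : ContDiff ℝ 1 F) (hF0 : F 0 = 0) (q : ℝ) (hq2 : 2 ≤ q)
    (hq : (q : EReal) < EllipticSystem.criticalExponent N) (K : NNReal)
    (hK : ∀ v, ‖fderiv ℝ F v‖ ≤ K * (‖v‖ + ‖v‖ ^ (q - 1))) :
    (∃ hint : ∀ u : EllipticSystem.H1 N k, Integrable (fun x => F (u.toFun x)) volume,
      Continuous (EllipticSystem.nemytski F hint) ∧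
      Differentiable ℝ (EllipticSystem.nemytski F hint)) ∧
    Differentiable ℝ (EllipticSystem.energy (N := N) F) := by
  obtain ⟨r, hqr, hr⟩ := EllipticSystem.exists_le_sobolevInequality hN hq
  have hKr : ∀ v, ‖fderiv ℝ F v‖ ≤ (2 * K : NNReal) * (‖v‖ + ‖v‖ ^ (r - 1)) := fun v => by
    have hpow := EllipticSystem.rpow_le_self_add_rpow (norm_nonneg v)
      (by linarith : 1 ≤ q - 1) (by linarith : q - 1 ≤ r - 1)
    calc ‖fderiv ℝ F v‖ ≤ K * (‖v‖ + ‖v‖ ^ (q - 1)) := hK v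
      _ ≤ K * ((‖v‖ + ‖v‖ ^ (r - 1)) + (‖v‖ + ‖v‖ ^ (r - 1))) := by
        gcongr
        exact le_add_of_nonneg_right (by positivity)
      _ = (2 * K : NNReal) * (‖v‖ + ‖v‖ ^ (r - 1)) := by push_cast; ring
  obtain ⟨hint, hd⟩ :=
    hr.exists_differentiable_nemytski_of_norm_fderiv_le (hq2.trans hqr) hF hF0 hKr
  exact ⟨⟨hint, hd.continuous, hd⟩, EllipticSystem.differentiable_energy hint hd⟩

theorem mainTheorem4 (N k : ℕ) (hN : 1 ≤ N) (hk : 1 ≤ k)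
    (F R : EllipticSystem.Eucl k → ℝ) (m : Fin k → ℝ) (hm : ∀ i, 0 < m i)
    (hF : ContDiff ℝ 1 F)
    (hFR : ∀ v, F v = 1 / 2 * ∑ i, m i ^ 2 * |v i| ^ 2 + R v)
    (hR0 : R 0 = 0)
    (p q c c' : ℝ) (hc : 0 ≤ c) (hc' : 0 ≤ c')
    (hp : 2 < p) (hpq : p ≤ q) (hq : (q : EReal) < EllipticSystem.criticalExponent N)
    (hgrowth : ∀ v, ‖gradient R v‖ ≤ c * ‖v‖ ^ (p - 1) + c' * ‖v‖ ^ (q - 1)) :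
    (∃ hint : ∀ u : EllipticSystem.H1 N k, Integrable (fun x => F (u.toFun x)) volume,
      Continuous (EllipticSystem.nemytski F hint) ∧
      Differentiable ℝ (EllipticSystem.nemytski F hint)) ∧
    Differentiable ℝ (EllipticSystem.energy (N := N) F) := by
  obtain ⟨K, hK⟩ := EllipticSystem.exists_norm_fderiv_le (hF.differentiable one_ne_zero) hFR hc hc'
    hp.le hpq hgrowth
  exact mainTheorem4_general N k hN F hF (by simp [hFR, hR0]) q (hp.le.trans hpq) hq K hK
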